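/- All sets are finite and all Hilbert spaces are finite-dimensional and nonzero. $\mathsf{L}(\mathcal H)$ denotes the linear operators on $\mathcal H$ and $\mathsf{S}(\mathcal H)$ the density operators (positive semidefinite, trace one). For a cq-state $\rho_{UQ}=\sum_{u}p(u)|u\rangle\langle u|_U\otimes\rho^u_Q$ (with $p$ a probability distribution and $\rho^u_Q$ density operators) the guessing probability is \[P_{\mathrm{guess}}(U|Q)_\rho=\max_{P}\sum_{u}p(u)\operatorname{Tr}[\rho^u_Q P^u],\] the maximum being over all POVMs $\{P^u\}_{u\in\mathcal U}$ on $\mathcal H_Q$ (i.e. $P^u\ge 0$, $\sum_u P^u=\mathbb 1$). For a bipartite density operator $\rho_{AQ}$ the conditional min-entropy is \[H_{\min}(A|Q)_\rho=-\inf_{\sigma_Q\in\mathsf S(\mathcal H_Q)}\inf\{\lambda\in\mathbb R:\rho_{AQ}\le 2^\lambda\,\mathbb 1_A\otimes\sigma_Q\}.\] **Corollary.** Let $\{\sigma^x_R:x\in\mathcal X\}\subset\mathsf S(\mathcal H_R)$ and $\{\tau^x_S:x\in\mathcal X\}\subset\mathsf S(\mathcal H_S)$ be two families of density operators (cq-channels).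 Let $\mathcal H_{S'}\cong\mathcal H_S$ be an auxiliary Hilbert space and let $\{\omega^y_{S'}:y\in\mathcal Y\}\subset\mathsf S(\mathcal H_{S'})$ be a family of density operators with $\operatorname{span}_{\mathbb C}\{\omega^y_{S'}:y\in\mathcal Y\}=\mathsf L(\mathcal H_{S'})$. For a finite set $\mathcal U$, a probability distribution $q(u)$ on $\mathcal U$ and a classical channel (conditional probability distribution) $q(y,x|u)$, put \[\sigma_{US'R}=\sum_{y,x,u}q(u)\,q(y,x|u)\,|u\rangle\langle u|_U\otimes\omega^y_{S'}\otimes\sigma^x_R,\qquad \tau_{US'S}=\sum_{y,x,u}q(u)\,q(y,x|u)\,|u\rangle\langle u|_U\otimes\omega^y_{S'}\otimes\tau^x_S .\] Then the following are equivalent: 1. for every finite set $\mathcal U$, every $q(u)$ and every $q(y,x|u)$, $H_{\min}(U|S'R)_\sigma\le H_{\min}(U|S'S)_\tau$; 2. for every finite set $\mathcal U$, every $q(u)$ and every $q(y,x|u)$, $P_{\mathrm{guess}}(U|S'R)_\sigma\ge P_{\mathrm{guess}}(U|S'S)_\tau$; 3. there exists a completely positive trace-preserving linear map $\mathcal T:\mathsf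 L(\mathcal H_R)\to\mathsf L(\mathcal H_S)$ such that $\tau^x_S=\mathcal T(\sigma^x_R)$ for all $x\in\mathcal X$. -/

import Mathlib

open scoped Matrix.Norms.L2Operator MatrixOrder ComplexOrder CStarAlgebra Kronecker

noncomputable section

namespace CQ

/-- Density operators on the finite-dimensional Hilbert space `ℂ^n`; operators are written as
matrices in a fixed orthonormal basis. -/
def IsDensity {n : Type*} [Fintype n] (ρ : Matrix n n ℂ) : Prop :=
  ρ.PosSemidef ∧ ρ.trace = 1

/-- POVMs on `ℂ^n` with finite outcome set `U`. -/
def IsPOVM {U n : Type*} [Fintype U] [Fintype n] [DecidableEq n] (P : U → Matrix n n ℂ) : Prop :=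
  (∀ u, (P u).PosSemidef) ∧ ∑ u, P u = 1

/-- The cq-state `∑ u, p(u) |u⟩⟨u| ⊗ ρ^u`. -/
def cqState {U n : Type*} [Fintype U] [DecidableEq U] (p : U → ℝ) (ρ : U → Matrix n n ℂ) :
    Matrix (U × n) (U × n) ℂ :=
  ∑ u, p u • (Matrix.single u u (1 : ℂ) ⊗ₖ ρ u)

/-- The conditional min-entropy `H_min(A|B)_ρ` of a bipartite operator `ρ` on `ℂ^a ⊗ ℂ^b`,
`- inf_σ inf {l : ρ ≤ 2^l (1 ⊗ σ)}` over density operators `σ` on `ℂ^b`. The two infima are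
merged into one, so that a `σ` for which no `l` is feasible contributes nothing. -/
def Hmin {a b : Type*} [Fintype a] [Fintype b] [DecidableEq a] [DecidableEq b]
    (ρ : Matrix (a × b) (a × b) ℂ) : ℝ :=
  -sInf {l : ℝ | ∃ σ : Matrix b b ℂ, IsDensity σ ∧
    ρ ≤ (2 : ℝ) ^ l • ((1 : Matrix a a ℂ) ⊗ₖ σ)}

/-- The guessing probability `P_guess(U|Q)` of the cq-state `∑ u, p(u) |u⟩⟨u| ⊗ ρ^u`. -/
def guessProb {U n : Type*} [Fintype U] [Fintype n] [DecidableEq n]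
    (p : U → ℝ) (ρ : U → Matrix n n ℂ) : ℝ :=
  sSup {v : ℝ | ∃ P : U → Matrix n n ℂ, IsPOVM P ∧ v = ∑ u, p u * ((ρ u * P u).trace).re}

/-- The average state `∑ y, ∑ x, c(y,x) ω^y ⊗ σ^x` prepared when the pair `(y,x)` is drawn with
probability `c(y,x)`. -/
def mixture {X Y m n : Type*} [Fintype X] [Fintype Y] (c : Y × X → ℝ)
    (ω : Y → Matrix m m ℂ) (σ : X → Matrix n n ℂ) : Matrix (m × n) (m × n) ℂ :=
  ∑ y, ∑ x, c (y, x) • (ω y ⊗ₖ σ x)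

end CQ

end

/-! The entropy and guessing conditions agree because semidefinite duality gives `Hmin = -logb 2
guessProb` on cq-states (`Hmin_cqState`). A channel implies domination because its trace dual pulls
measurements back (`guessProb_le_of_cp`). The substance is the passage from domination to a channel.
The statistics that POVMs on `S'R` produce on the products of `ω y` and `σ x` form a compact convex
set. If it missed the statistics of some POVM on `S'S`, a separating functional, shifted and
normalised, would be a guessing game violating domination (`exists_isPOVM_statistics_eq`). So every
measurement on `S'S` is simulated by one on `S'R`, and since the `ω y` span, the agreement extends
to all operators on `S'` (`trace_eq_of_statistics_eq`). Apply this to the generalised Bell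
measurement. Teleportation with the simulating POVM in place of the Bell measurement is a channel
from `R` to `S`; on `σ x` it yields what true teleportation yields on `τ x`, namely `τ x`
(`exists_channel`). -/

namespace CQ

open Matrix

/-! ### Trace pairing, positivity and compactness. -/

section Basic

variable {n : Type*} [Fintype n]

theorem trace_mul_nonneg [DecidableEq n] {A B : Matrix n n ℂ} (hA : A.PosSemidef)
    (hB : B.PosSemidef) : 0 ≤ (A * B).trace := by
  obtain ⟨C, rfl⟩ := CStarAlgebra.nonneg_iff_eq_star_mul_self.mp hA.nonneg
  rw [Matrix.mul_assoc, trace_mul_comm]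
  exact (hB.mul_mul_conjTranspose_same C).trace_nonneg

theorem trace_vecMulVec_mul (A : Matrix n n ℂ) (x y : n → ℂ) :
    (vecMulVec x y * A).trace = y ⬝ᵥ (A *ᵥ x) := by
  rw [trace_mul_comm, mul_vecMulVec, trace_vecMulVec, dotProduct_comm]

/-- Over `ℂ` a real quadratic form forces Hermiticity, so it need not be assumed. -/
theorem posSemidef_of_dotProduct_mulVec_nonneg [DecidableEq n] {A : Matrix n n ℂ}
    (h : ∀ x, 0 ≤ star x ⬝ᵥ (A *ᵥ x)) : A.PosSemidef := by
  rw [← isPositive_toEuclideanLin_iff, LinearMap.isPositive_iff_complex]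
  intro x
  have h1 : inner ℂ (Matrix.toEuclideanLin A x) x
      = star (star x.ofLp ⬝ᵥ (A *ᵥ x.ofLp)) := by
    rw [EuclideanSpace.inner_eq_star_dotProduct, Matrix.ofLp_toLpLin, toLin'_apply,
      star_dotProduct, star_star, dotProduct_comm]
  have h2 := h x.ofLp
  rw [Complex.nonneg_iff] at h2
  rw [h1]
  refine ⟨?_, ?_⟩
  · apply Complex.ext
    · simp
    · simp [← h2.2]
  · simpa using h2.1

/-- Linear functionals on matrices are given by the trace pairing. -/
theorem exists_eq_trace_mul [DecidableEq n] (f : Matrix n n ℂ →ₗ[ℂ] ℂ) :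
    ∃ B : Matrix n n ℂ, ∀ A, f A = (A * B).trace := by
  refine ⟨Matrix.of fun j i => f (single i j 1), fun A => ?_⟩
  conv_lhs => rw [matrix_eq_sum_single A]
  simp only [map_sum, trace, diag_apply, mul_apply, of_apply]
  refine Finset.sum_congr rfl fun i _ => Finset.sum_congr rfl fun j _ => ?_
  rw [← mul_one (A i j), ← smul_eq_mul (A i j), ← smul_single, map_smul]
  simp

theorem posSemidef_of_trace_nonneg [DecidableEq n] {B : Matrix n n ℂ}
    (h : ∀ A : Matrix n n ℂ, A.PosSemidef → 0 ≤ (A * B).trace) : B.PosSemidef :=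
  posSemidef_of_dotProduct_mulVec_nonneg fun x => by
    rw [← trace_vecMulVec_mul]
    exact h _ (posSemidef_vecMulVec_self_star x)

theorem eq_of_trace_mul_eq [DecidableEq n] {B C : Matrix n n ℂ}
    (h : ∀ A : Matrix n n ℂ, (A * B).trace = (A * C).trace) : B = C := by
  ext i j
  have := h (single j i 1)
  simpa [trace_single_mul] using this

/-- On Hermitian matrices, the real part of a linear functional is the trace pairing with a
Hermitian matrix. -/
theorem exists_isHermitian_re_eq_trace_mul [DecidableEq n] (f : Matrix n n ℂ →ₗ[ℂ] ℂ) :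
    ∃ B : Matrix n n ℂ, B.IsHermitian ∧
      ∀ A : Matrix n n ℂ, A.IsHermitian → ((A * B).trace).re = (f A).re := by
  obtain ⟨B, hB⟩ := exists_eq_trace_mul f
  refine ⟨(1 / 2 : ℝ) • (B + Bᴴ), ?_, fun A hA => ?_⟩
  · simp only [IsHermitian, conjTranspose_smul, conjTranspose_add, conjTranspose_conjTranspose,
      star_trivial, add_comm]
  · have h1 : (A * Bᴴ).trace = star (A * B).trace := by
      rw [← trace_conjTranspose, conjTranspose_mul, hA.eq, trace_mul_comm]
    rw [hB, Matrix.mul_smul, Matrix.mul_add, trace_smul, trace_add, h1]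
    simp
    ring

theorem posSemidef_of_isHermitian_of_re_trace_nonneg [DecidableEq n] {B : Matrix n n ℂ}
    (hB : B.IsHermitian)
    (h : ∀ A : Matrix n n ℂ, A.PosSemidef → 0 ≤ ((A * B).trace).re) : B.PosSemidef := by
  refine posSemidef_of_trace_nonneg fun A hA => ?_
  rw [Complex.nonneg_iff]
  refine ⟨h A hA, ?_⟩
  have h1 : star (A * B).trace = (A * B).trace := by
    rw [← trace_conjTranspose, conjTranspose_mul, hA.1.eq, hB.eq, trace_mul_comm]
  have := congrArg Complex.im h1
  simp at this
  linarith

theorem le_one_of_posSemidef_of_trace_eq_one [DecidableEq n] {A : Matrix n n ℂ} (hA : A.PosSemidef)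
    (ht : A.trace = 1) : A ≤ 1 := by
  have : A ≤ algebraMap ℝ (Matrix n n ℂ) 1 := by
    refine le_algebraMap_of_spectrum_le (p := IsSelfAdjoint) ?_ hA.1
    rw [hA.1.spectrum_real_eq_range_eigenvalues]
    rintro _ ⟨i, rfl⟩
    have h1 : (∑ i, hA.1.eigenvalues i : ℝ) = 1 := by
      have := hA.1.trace_eq_sum_eigenvalues
      rw [ht] at this
      apply Complex.ofReal_injective
      simpa using this.symm
    rw [← h1]
    exact Finset.single_le_sum (f := hA.1.eigenvalues) (fun j _ => hA.eigenvalues_nonneg j)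
      (Finset.mem_univ i)
  simpa using this

theorem convex_posSemidef {n : Type*} : Convex ℝ {A : Matrix n n ℂ | A.PosSemidef} := by
  intro A hA B hB a b ha hb _
  exact (PosSemidef.smul hA ha).add (PosSemidef.smul hB hb)

theorem isClosed_posSemidef [DecidableEq n] : IsClosed {A : Matrix n n ℂ | A.PosSemidef} := by
  simpa only [nonneg_iff_posSemidef] using CStarAlgebra.isClosed_nonneg (A := Matrix n n ℂ)

theorem isCompact_posSemidef_le_one [DecidableEq n] :
    IsCompact {A : Matrix n n ℂ | A.PosSemidef ∧ A ≤ 1} := by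
  have : ProperSpace (Matrix n n ℂ) := FiniteDimensional.proper ℂ _
  refine (isCompact_closedBall (0 : Matrix n n ℂ) 1).of_isClosed_subset
    (isClosed_posSemidef.inter isClosed_Iic) fun A hA => ?_
  rw [mem_closedBall_zero_iff]
  exact (CStarAlgebra.norm_le_one_iff_of_nonneg A hA.1.nonneg).2 hA.2

theorem isCompact_isDensity [DecidableEq n] : IsCompact {A : Matrix n n ℂ | IsDensity A} := by
  refine isCompact_posSemidef_le_one.of_isClosed_subset ?_
    fun A hA => ⟨hA.1, le_one_of_posSemidef_of_trace_eq_one hA.1 hA.2⟩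
  exact isClosed_posSemidef.inter
    (isClosed_eq (continuous_id.matrix_trace) continuous_const)

theorem convex_isDensity : Convex ℝ {A : Matrix n n ℂ | IsDensity A} := by
  intro A hA B hB a b ha hb hab
  refine ⟨convex_posSemidef hA.1 hB.1 ha hb hab, ?_⟩
  rw [trace_add, trace_smul, trace_smul, hA.2, hB.2]
  simp only [Complex.real_smul, mul_one]
  exact_mod_cast hab

end Basic

/-! ### Measurements and the guessing probability. -/

section POVM

variable {U n : Type*} [Fintype U] [Fintype n] [DecidableEq n]

theorem IsPOVM.le_one {P : U → Matrix n n ℂ} (hP : IsPOVM P) (u : U) : P u ≤ 1 := by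
  rw [← hP.2]
  exact Finset.single_le_sum (f := P) (fun v _ => (hP.1 v).nonneg) (Finset.mem_univ u)

theorem isCompact_isPOVM : IsCompact {P : U → Matrix n n ℂ | IsPOVM P} := by
  refine (isCompact_univ_pi fun _ : U => isCompact_posSemidef_le_one (n := n)).of_isClosed_subset
    ?_ fun P hP u _ => ⟨hP.1 u, hP.le_one u⟩
  have h1 : IsClosed {P : U → Matrix n n ℂ | ∀ u, (P u).PosSemidef} := by
    rw [Set.ofPred_forall]
    refine isClosed_iInter fun u => ?_
    exact isClosed_posSemidef.preimage (f := fun P : U → Matrix n n ℂ => P u) (by fun_prop)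
  exact h1.inter (isClosed_eq (by fun_prop) continuous_const)

theorem convex_isPOVM : Convex ℝ {P : U → Matrix n n ℂ | IsPOVM P} := by
  intro P hP Q hQ a b ha hb hab
  refine ⟨fun u => convex_posSemidef (hP.1 u) (hQ.1 u) ha hb hab, ?_⟩
  simp only [Pi.add_apply, Pi.smul_apply, Finset.sum_add_distrib, ← Finset.smul_sum, hP.2, hQ.2]
  rw [← add_smul, hab, one_smul]

/-- Raising one element of a sub-normalised family by the missing weight gives a POVM. -/
theorem isPOVM_add_single [DecidableEq U] {P : U → Matrix n n ℂ} (hP : ∀ u, (P u).PosSemidef)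
    (hs : (1 - ∑ u, P u).PosSemidef) (u₀ : U) :
    IsPOVM (P + Pi.single u₀ (1 - ∑ u, P u)) := by
  constructor
  · intro u
    refine (hP u).add ?_
    by_cases h : u = u₀
    · subst h; simpa using hs
    · simpa [h] using PosSemidef.zero
  · simp only [Pi.add_apply, Finset.sum_add_distrib]
    simp

theorem exists_isPOVM [Nonempty U] : ∃ P : U → Matrix n n ℂ, IsPOVM P := by
  classical
  refine ⟨_, isPOVM_add_single (P := fun _ : U => (0 : Matrix n n ℂ)) (fun _ => PosSemidef.zero)
    (by simpa using PosSemidef.one) (Classical.arbitrary U)⟩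

theorem bddAbove_guess (p : U → ℝ) (ρ : U → Matrix n n ℂ) :
    BddAbove {v : ℝ | ∃ P : U → Matrix n n ℂ, IsPOVM P ∧
      v = ∑ u, p u * ((ρ u * P u).trace).re} := by
  have hc : Continuous fun P : U → Matrix n n ℂ => ∑ u, p u * ((ρ u * P u).trace).re := by
    refine continuous_finsetSum _ fun u _ => continuous_const.mul ?_
    refine Complex.continuous_re.comp (Continuous.matrix_trace ?_)
    fun_prop
  refine ((isCompact_isPOVM (U := U) (n := n)).image hc).bddAbove.mono ?_
  rintro v ⟨P, hP, rfl⟩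
  exact ⟨P, hP, rfl⟩

theorem le_guessProb (p : U → ℝ) (ρ : U → Matrix n n ℂ) {P : U → Matrix n n ℂ} (hP : IsPOVM P) :
    ∑ u, p u * ((ρ u * P u).trace).re ≤ guessProb p ρ :=
  le_csSup (bddAbove_guess p ρ) ⟨P, hP, rfl⟩

theorem guessProb_le [Nonempty U] {p : U → ℝ} {ρ : U → Matrix n n ℂ} {r : ℝ}
    (h : ∀ P : U → Matrix n n ℂ, IsPOVM P → ∑ u, p u * ((ρ u * P u).trace).re ≤ r) :
    guessProb p ρ ≤ r := by
  obtain ⟨P, hP⟩ := exists_isPOVM (U := U) (n := n)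
  refine csSup_le ⟨_, P, hP, rfl⟩ ?_
  rintro v ⟨P, hP, rfl⟩
  exact h P hP

end POVM

/-! ### Semidefinite duality and the min-entropy. -/

section Duality

variable {U n : Type*} [Fintype U] [Fintype n] [DecidableEq n]

theorem isDensity_normalised_vecMulVec {n : Type*} [Fintype n] {x : n → ℂ} (hx : x ≠ 0) :
    IsDensity ((star x ⬝ᵥ x).re⁻¹ • vecMulVec x (star x)) := by
  have h0 : 0 < star x ⬝ᵥ x := dotProduct_star_self_pos_iff.2 hx
  rw [Complex.pos_iff] at h0
  refine ⟨(posSemidef_vecMulVec_self_star x).smul (inv_nonneg.2 h0.1.le), ?_⟩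
  rw [trace_smul, trace_vecMulVec]
  have h1 : x ⬝ᵥ star x = ((star x ⬝ᵥ x).re : ℂ) := by
    rw [dotProduct_comm]
    exact Complex.ext rfl h0.2.symm
  rw [h1, Complex.real_smul, ← Complex.ofReal_mul,
    inv_mul_cancel₀ h0.1.ne', Complex.ofReal_one]

theorem exists_isDensity {n : Type*} [Fintype n] [Nonempty n] : ∃ σ : Matrix n n ℂ, IsDensity σ :=
  ⟨_, isDensity_normalised_vecMulVec (x := fun _ => 1)
    fun h => one_ne_zero (congrFun h (Classical.arbitrary n))⟩

/-- A Hermitian matrix whose expectation in every state is bounded by `c` is at most `c • 1`. -/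
theorem le_smul_one_of_isDensity {A : Matrix n n ℂ} (hA : A.IsHermitian) {c : ℝ}
    (h : ∀ σ : Matrix n n ℂ, IsDensity σ → ((σ * A).trace).re ≤ c) :
    A ≤ c • (1 : Matrix n n ℂ) := by
  rw [Matrix.le_iff]
  have hH : (c • (1 : Matrix n n ℂ) - A).IsHermitian := by
    refine IsHermitian.sub ?_ hA
    simp [IsHermitian, conjTranspose_smul]
  refine .of_dotProduct_mulVec_nonneg hH fun x => ?_
  rcases eq_or_ne x 0 with rfl | hx
  · simp
  have h0 : 0 < star x ⬝ᵥ x := dotProduct_star_self_pos_iff.2 hx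
  rw [Complex.pos_iff] at h0
  have h1 := h _ (isDensity_normalised_vecMulVec hx)
  rw [smul_mul, trace_smul, trace_vecMulVec_mul, Complex.smul_re, smul_eq_mul,
    inv_mul_le_iff₀ h0.1] at h1
  have h2 : (star x ⬝ᵥ (A *ᵥ x)).im = 0 := hA.im_star_dotProduct_mulVec_self x
  rw [sub_mulVec, dotProduct_sub, smul_mulVec, one_mulVec, dotProduct_smul, Complex.nonneg_iff]
  simp only [Complex.sub_re, Complex.smul_re, Complex.sub_im, Complex.smul_im, smul_eq_mul, h2,
    ← h0.2]
  exact ⟨by linarith, by simp⟩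

/-- Strong duality for the guessing probability. -/
theorem exists_isDensity_dominating [Nonempty U] [Nonempty n] {p : U → ℝ} {ρ : U → Matrix n n ℂ}
    (hp : ∀ u, 0 ≤ p u) (hρ : ∀ u, (ρ u).PosSemidef) {v : ℝ} (hv0 : 0 < v) (hv : guessProb p ρ < v) :
    ∃ σ : Matrix n n ℂ, IsDensity σ ∧ ∀ u, p u • ρ u ≤ v • σ := by
  classical
  by_contra! hcon
  -- If no state dominates, the compact convex set of slack tuples misses the closed cone of
  -- positive tuples. The separating functional will be a positive tuple `P`, which rescales to a
  -- POVM of value at least `v`.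
  let F : Matrix n n ℂ → U → Matrix n n ℂ := fun σ u => v • σ - p u • ρ u
  have hF : Continuous F := by fun_prop
  let t : Set (U → Matrix n n ℂ) := Set.univ.pi fun _ => {A | A.PosSemidef}
  have ht0 : (0 : U → Matrix n n ℂ) ∈ t := fun u _ => PosSemidef.zero
  have hconv : Convex ℝ (F '' {σ | IsDensity σ}) := by
    rintro _ ⟨A, hA, rfl⟩ _ ⟨B, hB, rfl⟩ a b ha hb hab
    refine ⟨a • A + b • B, convex_isDensity hA hB ha hb hab, ?_⟩
    funext u
    simp only [F, Pi.add_apply, Pi.smul_apply]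
    rw [eq_sub_of_add_eq hab]
    module
  obtain ⟨f, r, s, hs, hrs, ht⟩ := RCLike.geometric_hahn_banach_compact_closed (𝕜 := ℂ)
    hconv (isCompact_isDensity.image hF)
    (convex_pi fun (_ : U) _ => convex_posSemidef (n := n))
    (isClosed_set_pi fun (_ : U) _ => isClosed_posSemidef (n := n)) (by
      rw [Set.disjoint_left]
      rintro _ ⟨σ, hσ, rfl⟩ h
      obtain ⟨u, hu⟩ := hcon σ hσ
      exact hu (Matrix.le_iff.2 (h u trivial)))
  have hs0 : s < 0 := by simpa using ht 0 ht0
  have htpos : ∀ A ∈ t, 0 ≤ (f A).re := by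
    intro A hA
    by_contra! hneg
    -- A functional bounded below on a cone is nonnegative there: this scaling would take the value
    -- exactly `s`, against the strict bound.
    have h1 := ht ((s / (f A).re) • A) fun u hu =>
      PosSemidef.smul (hA u hu) (div_nonneg_of_nonpos hs0.le hneg.le)
    have h2 : f ((s / (f A).re) • A) = ((s / (f A).re : ℝ) : ℂ) * f A := by
      rw [← smul_eq_mul, ← map_smul]; rfl
    rw [h2] at h1
    simp only [RCLike.re_to_complex, Complex.re_ofReal_mul] at h1
    rw [div_mul_cancel₀ _ hneg.ne] at h1
    exact lt_irrefl _ h1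
  choose P hPH hP using fun u => exists_isHermitian_re_eq_trace_mul
    ((f : (U → Matrix n n ℂ) →ₗ[ℂ] ℂ) ∘ₗ LinearMap.single ℂ (fun _ => Matrix n n ℂ) u)
  have hfsum : ∀ A : U → Matrix n n ℂ, (∀ u, (A u).IsHermitian) →
      (f A).re = ∑ u, ((A u * P u).trace).re := by
    intro A hA
    conv_lhs => rw [← Finset.univ_sum_single A]
    rw [map_sum, Complex.re_sum]
    exact Finset.sum_congr rfl fun u _ => ((hP u _ (hA u)).trans rfl).symm
  have hPpos : ∀ u, (P u).PosSemidef := by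
    refine fun u => posSemidef_of_isHermitian_of_re_trace_nonneg (hPH u) fun A hA => ?_
    rw [hP u A hA.1]
    refine htpos _ fun w _ => ?_
    by_cases h : w = u
    · subst h; simpa using hA
    · simpa [h] using PosSemidef.zero
  set c : ℝ := ∑ u, p u * ((ρ u * P u).trace).re with hc
  have hlt : ∀ σ : Matrix n n ℂ, IsDensity σ → v * ((σ * ∑ u, P u).trace).re < c := by
    intro σ hσ
    have h1 := (hs _ ⟨σ, hσ, rfl⟩).trans (hrs.trans hs0)
    rw [RCLike.re_to_complex, hfsum _ fun u => IsHermitian.sub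
      (hσ.1.smul hv0.le).1 ((hρ u).1.smul (IsSelfAdjoint.all _))] at h1
    simp only [sub_mul, trace_sub, smul_mul, trace_smul, Complex.sub_re, Complex.smul_re,
      smul_eq_mul, Finset.sum_sub_distrib, ← Finset.mul_sum] at h1
    rw [Finset.mul_sum, trace_sum, Complex.re_sum]
    linarith
  have hSpos : (∑ u, P u).PosSemidef := posSemidef_sum _ fun u _ => hPpos u
  obtain ⟨σ₀, hσ₀⟩ := exists_isDensity (n := n)
  have hc0 : 0 < c := lt_of_le_of_lt
    (mul_nonneg hv0.le (Complex.nonneg_iff.1 (trace_mul_nonneg hσ₀.1 hSpos)).1) (hlt σ₀ hσ₀)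
  -- Hence the tuple `(v / c) • P` is sub-normalised, and its value is exactly `v`; giving the
  -- missing weight to one outcome cannot lower it.
  have hle : (∑ u, P u) ≤ (c / v) • (1 : Matrix n n ℂ) :=
    le_smul_one_of_isDensity hSpos.1 fun σ hσ => by
      rw [le_div_iff₀ hv0, mul_comm]
      exact (hlt σ hσ).le
  have hvc : 0 ≤ v / c := div_nonneg hv0.le hc0.le
  have hrem : (1 - ∑ u, (v / c) • P u).PosSemidef := by
    have := (Matrix.le_iff.1 hle).smul hvc
    rwa [smul_sub, smul_smul, div_mul_div_cancel₀ hc0.ne', div_self hv0.ne', one_smul,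
      Finset.smul_sum] at this
  let u₀ : U := Classical.arbitrary U
  have hval := le_guessProb p ρ (isPOVM_add_single (fun u => (hPpos u).smul hvc) hrem u₀)
  have hge : v ≤ ∑ u, p u * ((ρ u * ((v / c) • P u +
      (Pi.single u₀ (1 - ∑ u, (v / c) • P u) : U → Matrix n n ℂ) u)).trace).re := by
    have h1 : ∑ u, p u * ((ρ u * ((v / c) • P u)).trace).re = v := by
      simp only [Matrix.mul_smul, trace_smul, Complex.smul_re, smul_eq_mul,
        mul_left_comm _ (v / c)]
      rw [← Finset.mul_sum, ← hc, div_mul_cancel₀ _ hc0.ne']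
    refine h1.symm.le.trans (Finset.sum_le_sum fun u _ => mul_le_mul_of_nonneg_left ?_ (hp u))
    rw [Matrix.mul_add, trace_add, Complex.add_re, le_add_iff_nonneg_right]
    by_cases h : u = u₀
    · rw [h, Pi.single_eq_same]
      exact (Complex.nonneg_iff.1 (trace_mul_nonneg (hρ u₀) hrem)).1
    · simp [h]
  exact absurd hv (not_lt.2 (hge.trans hval))

/-- Weak duality for the guessing probability. -/
theorem guessProb_le_of_dominated [Nonempty U] {p : U → ℝ} {ρ : U → Matrix n n ℂ} {v : ℝ}
    {σ : Matrix n n ℂ} (hσ : IsDensity σ) (h : ∀ u, p u • ρ u ≤ v • σ) : guessProb p ρ ≤ v := by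
  refine guessProb_le fun P hP => ?_
  have h1 : ∀ u, p u * ((ρ u * P u).trace).re ≤ v * ((σ * P u).trace).re := by
    intro u
    have := (Complex.nonneg_iff.1 (trace_mul_nonneg (Matrix.le_iff.1 (h u)) (hP.1 u))).1
    simp only [sub_mul, trace_sub, smul_mul, trace_smul, Complex.sub_re, Complex.smul_re,
      smul_eq_mul] at this
    linarith
  refine (Finset.sum_le_sum fun u _ => h1 u).trans ?_
  rw [← Finset.mul_sum, ← Complex.re_sum, ← trace_sum, ← Finset.mul_sum, hP.2, Matrix.mul_one, hσ.2]
  simp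

/-- Both sides are block diagonal in the classical register. -/
theorem cqState_le_iff {n : Type*} [Fintype n] [DecidableEq U] {p : U → ℝ} {ρ : U → Matrix n n ℂ} {σ : Matrix n n ℂ}
    {v : ℝ} :
    cqState p ρ ≤ v • ((1 : Matrix U U ℂ) ⊗ₖ σ) ↔ ∀ u, p u • ρ u ≤ v • σ := by
  have key : v • ((1 : Matrix U U ℂ) ⊗ₖ σ) - cqState p ρ =
      ∑ u, single u u (1 : ℂ) ⊗ₖ (v • σ - p u • ρ u) := by
    ext ⟨a, i⟩ ⟨b, j⟩
    simp only [cqState, Matrix.sub_apply, Matrix.smul_apply, Matrix.sum_apply, kroneckerMap_apply, single_apply,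
      one_apply]
    by_cases h : a = b
    · subst h
      simp
    · have : ∀ u, ¬ (u = a ∧ u = b) := fun u hu => h (hu.1.symm.trans hu.2)
      simp [h, this]
  rw [Matrix.le_iff, key]
  constructor
  · intro h u
    rw [Matrix.le_iff]
    convert h.submatrix fun i => (u, i) using 1
    ext i j
    simp only [submatrix_apply, Matrix.sum_apply, kroneckerMap_apply, single_apply]
    simp
  · intro h
    refine posSemidef_sum _ fun u _ => PosSemidef.kronecker ?_ (Matrix.le_iff.1 (h u))
    have : single u u (1 : ℂ) = vecMulVec (Pi.single u 1) (star (Pi.single u 1)) := by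
      ext i j
      simp only [single_apply, vecMulVec_apply, Pi.single_apply, Pi.star_apply, eq_comm (a := u)]
      by_cases hi : i = u <;> by_cases hj : j = u <;> simp [hi, hj]
    rw [this]
    exact posSemidef_vecMulVec_self_star _

theorem guessProb_pos {p : U → ℝ} (hp : p ∈ stdSimplex ℝ U) {ρ : U → Matrix n n ℂ}
    (hρ : ∀ u, IsDensity (ρ u)) : 0 < guessProb p ρ := by
  classical
  obtain ⟨u₀, -, hu₀⟩ : ∃ u ∈ Finset.univ, 0 < p u := by
    apply Finset.exists_lt_of_sum_lt
    simp [hp.2]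
  have h1 := le_guessProb p ρ (isPOVM_add_single (P := fun _ : U => (0 : Matrix n n ℂ))
    (fun _ => PosSemidef.zero) (by simpa using PosSemidef.one) u₀)
  refine lt_of_lt_of_le ?_ h1
  rw [Finset.sum_eq_single u₀]
  · simpa [(hρ u₀).2] using hu₀
  · intro u _ hu
    simp [hu]
  · simp

/-- Weak duality bounds every feasible exponent below; strong duality makes every exponent above the
logarithm feasible. Attainment is not needed. -/
theorem Hmin_cqState [DecidableEq U] {p : U → ℝ} (hp : p ∈ stdSimplex ℝ U)
    {ρ : U → Matrix n n ℂ} (hρ : ∀ u, IsDensity (ρ u)) :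
    Hmin (cqState p ρ) = -Real.logb 2 (guessProb p ρ) := by
  have hU : Nonempty U := by
    by_contra h
    rw [not_nonempty_iff] at h
    simpa using hp.2
  have hn : Nonempty n := by
    by_contra h
    rw [not_nonempty_iff] at h
    simpa [trace] using (hρ (Classical.arbitrary U)).2
  have hpos := guessProb_pos hp hρ
  have h2 : (1 : ℝ) < 2 := one_lt_two
  rw [Hmin, neg_inj]
  refine csInf_eq_of_forall_ge_of_forall_gt_exists_lt ?_ ?_ ?_
  · obtain ⟨σ, hσ, h⟩ := exists_isDensity_dominating hp.1 (fun u => (hρ u).1)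
      (hpos.trans (lt_add_one _)) (lt_add_one (guessProb p ρ))
    refine ⟨Real.logb 2 (guessProb p ρ + 1), σ, hσ, cqState_le_iff.2 ?_⟩
    rwa [Real.rpow_logb two_pos h2.ne' (by positivity)]
  · rintro l ⟨σ, hσ, h⟩
    rw [Real.logb_le_iff_le_rpow h2 hpos]
    exact guessProb_le_of_dominated hσ (cqState_le_iff.1 h)
  · intro w hw
    obtain ⟨l, hl, hlw⟩ := exists_between hw
    rw [Real.logb_lt_iff_lt_rpow h2 hpos] at hl
    obtain ⟨σ, hσ, h⟩ := exists_isDensity_dominating hp.1 (fun u => (hρ u).1)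
      (by positivity) hl
    exact ⟨l, ⟨σ, hσ, cqState_le_iff.2 h⟩, hlw⟩

end Duality

/-! ### Averaged product states. -/

section Mixture

variable {X Y m n : Type*} [Fintype X] [Fintype Y] [Fintype m] [Fintype n]

theorem isDensity_mixture {c : Y × X → ℝ} (hc : c ∈ stdSimplex ℝ (Y × X))
    {ω : Y → Matrix m m ℂ} (hω : ∀ y, IsDensity (ω y)) {σ : X → Matrix n n ℂ}
    (hσ : ∀ x, IsDensity (σ x)) : IsDensity (mixture c ω σ) := by
  constructor
  · exact posSemidef_sum _ fun y _ => posSemidef_sum _ fun x _ =>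
      ((hω y).1.kronecker (hσ x).1).smul (hc.1 _)
  · simp only [mixture, trace_sum, trace_smul, trace_kronecker, (hω _).2, (hσ _).2]
    have := hc.2
    rw [Fintype.sum_prod_type] at this
    simp only [mul_one, Complex.real_smul]
    exact_mod_cast this

end Mixture

/-! ### Block matrices and their positivity. -/

section Flatten

variable {k m : Type*} [Fintype k] [Fintype m] [DecidableEq m]

/-- Positivity of a matrix of matrices is positivity of the flattened matrix. -/
theorem cstarMatrix_nonneg_iff (M : CStarMatrix k k (Matrix m m ℂ)) :
    0 ≤ M ↔ (Matrix.of fun a b : k × m => M a.1 b.1 a.2 b.2).PosSemidef := by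
  classical
  constructor
  · intro h
    -- The positive cone is generated by star-squares, and flattening respects products and
    -- adjoints.
    rw [StarOrderedRing.nonneg_iff] at h
    induction h using AddSubmonoid.closure_induction with
    | mem M hM =>
      obtain ⟨N, rfl⟩ := hM
      convert posSemidef_conjTranspose_mul_self (Matrix.of fun a b : k × m => N a.1 b.1 a.2 b.2)
      ext ⟨i, a⟩ ⟨j, b⟩
      simp [CStarMatrix.mul_apply, CStarMatrix.star_apply, Matrix.mul_apply, Matrix.sum_apply,
        Fintype.sum_prod_type, Matrix.star_apply]
    | zero => exact PosSemidef.zero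
    | add M N _ _ hM hN => exact hM.add hN
  · intro h
    obtain ⟨B, hB⟩ := CStarAlgebra.nonneg_iff_eq_star_mul_self.mp h.nonneg
    let N : CStarMatrix k k (Matrix m m ℂ) :=
      CStarMatrix.ofMatrix (Matrix.of fun i j => Matrix.of fun a b => B (i, a) (j, b))
    have : M = star N * N := by
      ext i j a b
      have := congrFun (congrFun hB (i, a)) (j, b)
      simp only [of_apply, Matrix.mul_apply, Matrix.star_apply, Fintype.sum_prod_type] at this
      simp [CStarMatrix.mul_apply, CStarMatrix.star_apply, Matrix.mul_apply, Matrix.sum_apply,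
        Matrix.star_apply, this, N]
    rw [this]
    exact star_mul_self_nonneg N

end Flatten

/-! ### Channels acting on one tensor factor. -/

section Ampliation

variable {k m n : Type*} [Fintype k] [Fintype m] [Fintype n] [DecidableEq m] [DecidableEq n]

/-- The map `id ⊗ T`. -/
def ampliation (k : Type*) {m n : Type*} (T : Matrix m m ℂ →ₗ[ℂ] Matrix n n ℂ) :
    Matrix (k × m) (k × m) ℂ →ₗ[ℂ] Matrix (k × n) (k × n) ℂ where
  toFun A := Matrix.of fun a b => T (Matrix.of fun i j => A (a.1, i) (b.1, j)) a.2 b.2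
  map_add' A B := by
    ext a b
    simp only [of_apply, Matrix.add_apply]
    rw [← Matrix.add_apply, ← map_add]
    rfl
  map_smul' c A := by
    ext a b
    simp only [of_apply, Matrix.smul_apply, RingHom.id_apply]
    rw [← Matrix.smul_apply, ← map_smul]
    rfl

theorem ampliation_apply {k m n : Type*} (T : Matrix m m ℂ →ₗ[ℂ] Matrix n n ℂ) (A : Matrix (k × m) (k × m) ℂ)
    (a b : k × n) :
    ampliation k T A a b = T (Matrix.of fun i j => A (a.1, i) (b.1, j)) a.2 b.2 := rfl

theorem ampliation_kronecker {k m n : Type*} (T : Matrix m m ℂ →ₗ[ℂ] Matrix n n ℂ) (W : Matrix k k ℂ)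
    (A : Matrix m m ℂ) : ampliation k T (W ⊗ₖ A) = W ⊗ₖ T A := by
  ext a b
  rw [ampliation_apply, kroneckerMap_apply, ← smul_eq_mul, ← Matrix.smul_apply, ← map_smul]
  rfl

theorem trace_ampliation {k m n : Type*} [Fintype k] [Fintype m] [Fintype n]
    (T : Matrix m m ℂ →ₗ[ℂ] Matrix n n ℂ)
    (hT : ∀ A, (T A).trace = A.trace) (A : Matrix (k × m) (k × m) ℂ) :
    (ampliation k T A).trace = A.trace := by
  simp only [trace, diag_apply, Fintype.sum_prod_type, ampliation_apply]
  refine Finset.sum_congr rfl fun i _ => ?_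
  simpa [trace] using hT (Matrix.of fun a b => A (i, a) (i, b))

theorem ampliation_posSemidef (T : Matrix m m ℂ →CP Matrix n n ℂ)
    {A : Matrix (k × m) (k × m) ℂ} (hA : A.PosSemidef) :
    (ampliation k T.toLinearMap A).PosSemidef := by
  have := T.map_cstarMatrix_nonneg (CStarMatrix.ofMatrix
    (Matrix.of fun i j : k => Matrix.of fun a b => A (i, a) (j, b)))
    ((cstarMatrix_nonneg_iff _).2 hA)
  exact (cstarMatrix_nonneg_iff _).1 this

/-- A channel pulls back POVMs. -/
theorem exists_isPOVM_of_cp {U : Type*} [Fintype U] [DecidableEq k]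
    (T : Matrix m m ℂ →CP Matrix n n ℂ) (hT : ∀ A, (T A).trace = A.trace)
    {P : U → Matrix (k × n) (k × n) ℂ} (hP : IsPOVM P) :
    ∃ Q : U → Matrix (k × m) (k × m) ℂ, IsPOVM Q ∧
      ∀ u A, (A * Q u).trace = (ampliation k T.toLinearMap A * P u).trace := by
  -- Heisenberg picture: `Q u` represents the functional obtained by applying the channel and then
  -- testing with `P u`. Complete positivity gives positivity, trace preservation gives
  -- normalisation.
  choose Q hQ using fun u => exists_eq_trace_mul
    (traceLinearMap _ ℂ ℂ ∘ₗ LinearMap.mulRight ℂ (P u) ∘ₗ ampliation k T.toLinearMap)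
  have hQ' : ∀ u A, (A * Q u).trace = (ampliation k T.toLinearMap A * P u).trace :=
    fun u A => (hQ u A).symm
  refine ⟨Q, ⟨fun u => posSemidef_of_trace_nonneg fun A hA => ?_,
    eq_of_trace_mul_eq fun A => ?_⟩, hQ'⟩
  · rw [hQ']
    exact trace_mul_nonneg (ampliation_posSemidef T hA) (hP.1 u)
  · rw [Finset.mul_sum, trace_sum]
    simp only [hQ']
    rw [← trace_sum, ← Finset.mul_sum, hP.2, Matrix.mul_one, Matrix.mul_one]
    exact trace_ampliation _ hT A

theorem ampliation_mixture {k m n X Y : Type*} [Fintype X] [Fintype Y]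
    (T : Matrix m m ℂ →ₗ[ℂ] Matrix n n ℂ) (c : Y × X → ℝ) (ω : Y → Matrix k k ℂ)
    (σ : X → Matrix m m ℂ) :
    ampliation k T (mixture c ω σ) = mixture c ω fun x => T (σ x) := by
  simp only [mixture, map_sum, LinearMap.map_smul_of_tower, ampliation_kronecker]

theorem guessProb_le_of_cp {U X Y : Type*} [Fintype U] [Nonempty U] [Fintype X] [Fintype Y]
    [DecidableEq k]
    (T : Matrix m m ℂ →CP Matrix n n ℂ) (hT : ∀ A, (T A).trace = A.trace)
    (q : U → ℝ) (c : U → Y × X → ℝ) (ω : Y → Matrix k k ℂ) (σ : X → Matrix m m ℂ) :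
    guessProb q (fun u => mixture (c u) ω fun x => T (σ x)) ≤
      guessProb q (fun u => mixture (c u) ω σ) := by
  refine guessProb_le fun P hP => ?_
  obtain ⟨Q, hQ, h⟩ := exists_isPOVM_of_cp T hT hP
  refine le_trans (le_of_eq ?_) (le_guessProb q _ hQ)
  refine Finset.sum_congr rfl fun u _ => ?_
  rw [h, ampliation_mixture]
  rfl

end Ampliation

/-! ### Complete positivity of Kraus maps. -/

section Kraus

variable {z m n : Type*} [Fintype z] [Fintype m] [Fintype n] [DecidableEq m] [DecidableEq n]

/-- The completely positive map with given Kraus operators. -/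
noncomputable def krausMap (K : z → Matrix n m ℂ) : Matrix m m ℂ →CP Matrix n n ℂ where
  toFun A := ∑ i, K i * A * (K i)ᴴ
  map_add' A B := by simp [Matrix.mul_add, Matrix.add_mul, Finset.sum_add_distrib]
  map_smul' c A := by simp [Finset.smul_sum]
  map_cstarMatrix_nonneg' d M hM := by
    rw [cstarMatrix_nonneg_iff] at hM ⊢
    -- The ampliation has Kraus operators `1 ⊗ₖ K i`.
    have := posSemidef_sum Finset.univ fun (i : z) _ =>
      hM.mul_mul_conjTranspose_same ((1 : Matrix (Fin d) (Fin d) ℂ) ⊗ₖ K i)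
    convert this
    ext ⟨i, a⟩ ⟨j, b⟩
    simp [Matrix.sum_apply, Matrix.mul_apply, Fintype.sum_prod_type, one_apply,
      Finset.sum_mul, apply_ite]

theorem krausMap_apply (K : z → Matrix n m ℂ) (A : Matrix m m ℂ) :
    krausMap K A = ∑ i, K i * A * (K i)ᴴ := rfl

end Kraus

/-! ### Simulating measurement statistics. -/

section Statistics

variable {U X Y k m : Type*} [Fintype U] [Fintype X] [Fintype Y] [Fintype k] [Fintype m]

/-- The joint statistics of the measurement `Q` on the product states `ω y ⊗ σ x`. -/
noncomputable def statistics (ω : Y → Matrix k k ℂ) (σ : X → Matrix m m ℂ) :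
    (U → Matrix (k × m) (k × m) ℂ) →ₗ[ℝ] (U × Y × X → ℝ) where
  toFun Q t := (((ω t.2.1 ⊗ₖ σ t.2.2) * Q t.1).trace).re
  map_add' P Q := by
    funext t
    simp [Matrix.mul_add]
  map_smul' r Q := by
    funext t
    simp

theorem statistics_apply {U X Y : Type*} (ω : Y → Matrix k k ℂ) (σ : X → Matrix m m ℂ)
    (Q : U → Matrix (k × m) (k × m) ℂ) (t : U × Y × X) :
    statistics ω σ Q t = (((ω t.2.1 ⊗ₖ σ t.2.2) * Q t.1).trace).re := rfl

theorem guess_eq_sum_statistics (ω : Y → Matrix k k ℂ) (σ : X → Matrix m m ℂ)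
    (Q : U → Matrix (k × m) (k × m) ℂ) (q : U → ℝ) (c : U → Y × X → ℝ) :
    ∑ u, q u * ((mixture (c u) ω σ * Q u).trace).re =
      ∑ t : U × Y × X, q t.1 * c t.1 t.2 * statistics ω σ Q t := by
  simp only [Fintype.sum_prod_type, statistics_apply, mixture, Finset.sum_mul, trace_sum,
    Complex.re_sum, smul_mul, trace_smul, Complex.smul_re, smul_eq_mul, Finset.mul_sum, mul_assoc]

/-- The total does not depend on the measurement, so adding a constant to all coefficients of a
functional shifts its value equally for all POVMs. -/
theorem sum_statistics [DecidableEq k] [DecidableEq m] {ω : Y → Matrix k k ℂ}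
    {σ : X → Matrix m m ℂ}
    (hω : ∀ y, IsDensity (ω y)) (hσ : ∀ x, IsDensity (σ x))
    {Q : U → Matrix (k × m) (k × m) ℂ} (hQ : IsPOVM Q) :
    ∑ t : U × Y × X, statistics ω σ Q t = Fintype.card (Y × X) := by
  rw [Fintype.sum_prod_type_right]
  have : ∀ t : Y × X, ∑ u, statistics ω σ Q (u, t) = 1 := by
    intro t
    simp only [statistics_apply]
    rw [← Complex.re_sum, ← trace_sum, ← Finset.mul_sum, hQ.2, Matrix.mul_one, trace_kronecker,
      (hω _).2, (hσ _).2]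
    simp
  simp [this]

variable {n : Type*} [Fintype n] [DecidableEq k] [DecidableEq m] [DecidableEq n]

/-- Domination in guessing probability implies simulability of the statistics of every
measurement. -/
theorem exists_isPOVM_statistics_eq [Nonempty U]
    {ω : Y → Matrix k k ℂ} (hω : ∀ y, IsDensity (ω y))
    {σ : X → Matrix m m ℂ} (hσ : ∀ x, IsDensity (σ x))
    {τ : X → Matrix n n ℂ} (hτ : ∀ x, IsDensity (τ x))
    (hdom : ∀ (q : U → ℝ) (c : U → Y × X → ℝ),
      q ∈ stdSimplex ℝ U → (∀ u, c u ∈ stdSimplex ℝ (Y × X)) →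
      guessProb q (fun u => mixture (c u) ω σ) ≥ guessProb q (fun u => mixture (c u) ω τ))
    {P : U → Matrix (k × n) (k × n) ℂ} (hP : IsPOVM P) :
    ∃ Q : U → Matrix (k × m) (k × m) ℂ, IsPOVM Q ∧ statistics ω σ Q = statistics ω τ P := by
  classical
  by_contra! hcon
  rcases isEmpty_or_nonempty (Y × X) with hYX | hYX
  · obtain ⟨Q, hQ⟩ := exists_isPOVM (U := U) (n := k × m)
    exact hcon Q hQ (funext fun t => hYX.elim t.2)
  have hcont : Continuous (statistics ω σ : (U → Matrix (k × m) (k × m) ℂ) →ₗ[ℝ] _) :=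
    LinearMap.continuous_of_finiteDimensional _
  obtain ⟨f, r, hr, hrP⟩ := geometric_hahn_banach_closed_point
    (convex_isPOVM.linear_image (statistics ω σ))
    (isCompact_isPOVM.image hcont).isClosed
    (x := statistics ω τ P) (by
      rintro ⟨Q, hQ, h⟩
      exact hcon Q hQ h)
  set a : U × Y × X → ℝ := fun t => f (Pi.single t 1) with ha
  have hf : ∀ w, f w = ∑ t, a t * w t := by
    intro w
    conv_lhs => rw [← Finset.univ_sum_single w, map_sum]
    refine Finset.sum_congr rfl fun t _ => ?_
    rw [ha, mul_comm, ← smul_eq_mul, ← map_smul, ← Pi.single_smul, smul_eq_mul, mul_one]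
  -- Strict positivity after the shift keeps all the normalising denominators below nonzero, so the
  -- coefficients factor as a distribution `q` times a conditional distribution `c`.
  obtain ⟨C, hC⟩ : ∃ C : ℝ, ∀ t, 0 < a t + C := by
    refine ⟨1 + ∑ t, |a t|, fun t => ?_⟩
    have h1 := Finset.single_le_sum (f := fun t => |a t|) (fun t _ => abs_nonneg _)
      (Finset.mem_univ t)
    have h2 := neg_abs_le (a t)
    linarith
  set b : U × Y × X → ℝ := fun t => a t + C with hb
  have hbu : ∀ u, 0 < ∑ s, b (u, s) := fun u =>
    Finset.sum_pos (fun s _ => hC (u, s)) Finset.univ_nonempty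
  have hN : 0 < ∑ u, ∑ s, b (u, s) := Finset.sum_pos (fun u _ => hbu u) Finset.univ_nonempty
  set N := ∑ u, ∑ s, b (u, s) with hNdef
  let q : U → ℝ := fun u => (∑ s, b (u, s)) / N
  let c : U → Y × X → ℝ := fun u s => b (u, s) / ∑ s, b (u, s)
  have hq : q ∈ stdSimplex ℝ U :=
    ⟨fun u => (div_pos (hbu u) hN).le, by simp only [q]; rw [← Finset.sum_div, div_self hN.ne']⟩
  have hc : ∀ u, c u ∈ stdSimplex ℝ (Y × X) := fun u =>
    ⟨fun s => (div_pos (hC (u, s)) (hbu u)).le, by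
      simp only [c]; rw [← Finset.sum_div, div_self (hbu u).ne']⟩
  have hqc : ∀ t : U × Y × X, q t.1 * c t.1 t.2 = N⁻¹ * (a t + C) := by
    intro t
    have := (hbu t.1).ne'
    simp only [q, c]
    field_simp
    rfl
  have hsum : ∀ w : U × Y × X → ℝ, ∑ t, w t = Fintype.card (Y × X) →
      ∑ t : U × Y × X, q t.1 * c t.1 t.2 * w t = N⁻¹ * (f w + C * Fintype.card (Y × X)) := by
    intro w hw
    simp only [hqc, mul_assoc, ← Finset.mul_sum, add_mul, Finset.sum_add_distrib, hw, hf]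
  have hσle : guessProb q (fun u => mixture (c u) ω σ) ≤
      N⁻¹ * (r + C * Fintype.card (Y × X)) := by
    refine guessProb_le fun Q hQ => ?_
    rw [guess_eq_sum_statistics, hsum _ (sum_statistics hω hσ hQ)]
    have := (hr _ ⟨Q, hQ, rfl⟩).le
    gcongr
  have hτge : N⁻¹ * (f (statistics ω τ P) + C * Fintype.card (Y × X)) ≤
      guessProb q (fun u => mixture (c u) ω τ) := by
    rw [← hsum _ (sum_statistics hω hτ hP), ← guess_eq_sum_statistics]
    exact le_guessProb q (fun u => mixture (c u) ω τ) hP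
  have hlt : N⁻¹ * (r + C * Fintype.card (Y × X)) <
      N⁻¹ * (f (statistics ω τ P) + C * Fintype.card (Y × X)) := by
    have := inv_pos.2 hN
    gcongr
  exact absurd (hdom q c hq hc) (not_le.2 (hσle.trans_lt (hlt.trans_le hτge)))

/-- If the `ω y` span, equality of statistics extends to all operators on the first factor. -/
theorem trace_eq_of_statistics_eq {X Y : Type*}
    {ω : Y → Matrix k k ℂ} (hω : ∀ y, IsDensity (ω y))
    (hspan : Submodule.span ℂ (Set.range ω) = ⊤)
    {σ : X → Matrix m m ℂ} (hσ : ∀ x, IsDensity (σ x))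
    {τ : X → Matrix n n ℂ} (hτ : ∀ x, IsDensity (τ x))
    {P : U → Matrix (k × n) (k × n) ℂ} (hP : IsPOVM P)
    {Q : U → Matrix (k × m) (k × m) ℂ} (hQ : IsPOVM Q)
    (h : statistics ω σ Q = statistics ω τ P) (W : Matrix k k ℂ) (x : X) (u : U) :
    ((W ⊗ₖ σ x) * Q u).trace = ((W ⊗ₖ τ x) * P u).trace := by
  have hW : W ∈ Submodule.span ℂ (Set.range ω) := hspan ▸ Submodule.mem_top
  induction hW using Submodule.span_induction with
  | mem W hW =>
    obtain ⟨y, rfl⟩ := hW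
    -- `statistics` records real parts only; the traces are real, being pairings of positive
    -- operators.
    have h1 := Complex.nonneg_iff.1 (trace_mul_nonneg ((hω y).1.kronecker (hσ x).1) (hQ.1 u))
    have h2 := Complex.nonneg_iff.1 (trace_mul_nonneg ((hω y).1.kronecker (hτ x).1) (hP.1 u))
    exact Complex.ext (congrFun h (u, y, x)) (h1.2.symm.trans h2.2)
  | zero => simp
  | add V W _ _ hV hW => simp only [add_kronecker, Matrix.add_mul, trace_add, hV, hW]
  | smul r W _ hW => simp only [smul_kronecker, smul_mul, trace_smul, hW]

end Statistics

/-! ### Generalised Bell measurement and teleportation. -/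

section Teleportation

variable {k m n : Type*} [Fintype k] [DecidableEq k] [Fintype m] [DecidableEq m]
  [Fintype n] [DecidableEq n] {d : ℕ} [NeZero d]

/-- The unnormalised generalised Bell vectors. -/
noncomputable def bellVec (e' : k ≃ ZMod d) (e : n ≃ ZMod d) (u : ZMod d × ZMod d) : k × n → ℂ :=
  fun s => if s.1 = e'.symm (e s.2 + u.1) then ZMod.stdAddChar (u.2 * e s.2) else 0

/-- The generalised Bell measurement. -/
noncomputable def bell (e' : k ≃ ZMod d) (e : n ≃ ZMod d) (u : ZMod d × ZMod d) :
    Matrix (k × n) (k × n) ℂ :=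
  (d : ℝ)⁻¹ • vecMulVec (bellVec e' e u) (star (bellVec e' e u))

theorem star_stdAddChar (x : ZMod d) :
    star (ZMod.stdAddChar x : ℂ) = ZMod.stdAddChar (-x) :=
  (AddChar.map_neg_eq_conj _ _).symm

theorem stdAddChar_mul_sub (b x y : ZMod d) :
    (ZMod.stdAddChar (b * (x - y)) : ℂ) =
      ZMod.stdAddChar (b * x) * ZMod.stdAddChar (-(b * y)) := by
  rw [← AddChar.map_add_eq_mul, mul_sub, sub_eq_add_neg]

/-- Summing over phases `b` kills the entries with `s ≠ t` by character orthogonality; for `s = t`,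
exactly one shift `a` contributes to each diagonal entry. -/
theorem isPOVM_bell (e' : k ≃ ZMod d) (e : n ≃ ZMod d) : IsPOVM (bell e' e) := by
  refine ⟨fun u => (posSemidef_vecMulVec_self_star _).smul (by positivity), ?_⟩
  ext ⟨s', s⟩ ⟨t', t⟩
  have hd : (d : ℂ) ≠ 0 := Nat.cast_ne_zero.2 (NeZero.ne d)
  have key : ∀ a b : ZMod d, bell e' e (a, b) (s', s) (t', t) =
      if s' = e'.symm (e s + a) ∧ t' = e'.symm (e t + a) then
        (d : ℂ)⁻¹ * ZMod.stdAddChar (b * (e s - e t)) else 0 := by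
    intro a b
    simp only [bell, bellVec, Matrix.smul_apply, vecMulVec_apply, Pi.star_apply, Complex.real_smul,
      apply_ite star, star_stdAddChar, star_zero]
    by_cases h1 : s' = e'.symm (e s + a) <;> by_cases h2 : t' = e'.symm (e t + a) <;>
      simp [h1, h2, stdAddChar_mul_sub]
  rw [Matrix.sum_apply, Fintype.sum_prod_type]
  simp only [key]
  by_cases hst : s = t
  · subst hst
    simp only [sub_self, mul_zero, AddChar.map_zero_eq_one, mul_one, Finset.sum_const,
      Finset.card_univ, ZMod.card, nsmul_eq_mul, mul_ite, mul_inv_cancel₀ hd]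
    by_cases hs : s' = t'
    · subst hs
      rw [Finset.sum_eq_single (e' s' - e s)]
      · simp
      · intro a _ ha
        rw [if_neg]
        rintro ⟨h, -⟩
        apply ha
        rw [h]
        simp
      · simp
    · rw [Matrix.one_apply_ne (by simpa using hs)]
      refine Finset.sum_eq_zero fun a _ => if_neg ?_
      rintro ⟨h1, h2⟩
      exact hs (h1.trans h2.symm)
  · rw [Matrix.one_apply_ne (by simp [hst])]
    refine Finset.sum_eq_zero fun a _ => ?_
    by_cases h : s' = e'.symm (e s + a) ∧ t' = e'.symm (e t + a)
    · simp only [if_pos h, ← Finset.mul_sum]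
      rw [AddChar.sum_mulShift _ (ZMod.isPrimitive_stdAddChar d), if_neg]
      · simp
      · exact fun h => hst (e.injective (sub_eq_zero.1 h))
    · simp [h]

/-- Each outcome alone determines the entry `τ i j`, up to a known phase that the correction in
`exists_teleportation` undoes. -/
theorem trace_single_kronecker_mul_bell (e' : k ≃ ZMod d) (e : n ≃ ZMod d) (τ : Matrix n n ℂ)
    (u : ZMod d × ZMod d) (i j : n) :
    ((single (e'.symm (e i + u.1)) (e'.symm (e j + u.1)) (1 : ℂ) ⊗ₖ τ) * bell e' e u).trace =
      (d : ℂ)⁻¹ * ZMod.stdAddChar (u.2 * (e j - e i)) * τ i j := by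
  rw [bell, Matrix.mul_smul, trace_smul, trace_mul_comm, trace_vecMulVec_mul]
  have h1 : ∀ p q : k × n, star (bellVec e' e u p) *
      ((single (e'.symm (e i + u.1)) (e'.symm (e j + u.1)) (1 : ℂ) ⊗ₖ τ) p q * bellVec e' e u q) =
      if p = (e'.symm (e i + u.1), i) then (if q = (e'.symm (e j + u.1), j) then
        ZMod.stdAddChar (u.2 * (e j - e i)) * τ i j else 0) else 0 := by
    rintro ⟨p', p⟩ ⟨q', q⟩
    simp only [kroneckerMap_apply, single_apply, bellVec, apply_ite star, star_zero,
      star_stdAddChar, Prod.mk.injEq]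
    by_cases hp : p' = e'.symm (e i + u.1)
    · by_cases hq : q' = e'.symm (e j + u.1)
      · subst hp hq
        by_cases hi : i = p <;> by_cases hj : j = q <;>
          simp [hi, hj, stdAddChar_mul_sub, eq_comm]
        subst hi hj
        ring
      · simp [hq, Ne.symm hq]
    · simp [hp, Ne.symm hp]
  simp only [dotProduct, mulVec, Finset.mul_sum, Pi.star_apply, h1]
  simp [mul_assoc]

/-- The formula describes a protocol: share a maximally entangled state, measure `Q` on `ρ` and one
half, then correct the other half by the phase belonging to the outcome, the shift being absorbed in
the indices. -/
theorem exists_teleportation (e' : k ≃ ZMod d) (e : n ≃ ZMod d)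
    {Q : ZMod d × ZMod d → Matrix (k × m) (k × m) ℂ} (hQ : IsPOVM Q) :
    ∃ T : Matrix m m ℂ →CP Matrix n n ℂ, ∀ ρ i j, T ρ i j =
      (d : ℂ)⁻¹ * ∑ u : ZMod d × ZMod d, ZMod.stdAddChar (u.2 * (e i - e j)) *
        ((single (e'.symm (e i + u.1)) (e'.symm (e j + u.1)) (1 : ℂ) ⊗ₖ ρ) * Q u).trace := by
  choose B hB using fun u => CStarAlgebra.nonneg_iff_eq_star_mul_self.mp (hQ.1 u).nonneg
  -- Writing `Q u = star (B u) * B u`, each row of `B u` gives one Kraus operator; phase and shift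
  -- come from the correction, `(√d)⁻¹` from the entangled state.
  refine ⟨krausMap fun z : (ZMod d × ZMod d) × (k × m) => Matrix.of fun i r =>
    ((√d)⁻¹ : ℂ) * ZMod.stdAddChar (z.1.2 * e i) * B z.1 z.2 (e'.symm (e i + z.1.1), r), ?_⟩
  intro ρ i j
  have hd : ((√d : ℝ) : ℂ)⁻¹ * ((√d : ℝ) : ℂ)⁻¹ = (d : ℂ)⁻¹ := by
    rw [← mul_inv, ← Complex.ofReal_mul, Real.mul_self_sqrt (Nat.cast_nonneg d)]
    simp
  rw [krausMap_apply, Matrix.sum_apply, Fintype.sum_prod_type, Finset.mul_sum]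
  refine Finset.sum_congr rfl fun u _ => ?_
  have htr : ((single (e'.symm (e i + u.1)) (e'.symm (e j + u.1)) (1 : ℂ) ⊗ₖ ρ) * Q u).trace =
      ∑ r, ∑ s, ρ r s * Q u (e'.symm (e j + u.1), s) (e'.symm (e i + u.1), r) := by
    simp only [trace, diag_apply, Matrix.mul_apply, Fintype.sum_prod_type, kroneckerMap_apply,
      single_apply]
    rw [Finset.sum_eq_single (e'.symm (e i + u.1))]
    · refine Finset.sum_congr rfl fun r _ => ?_
      rw [Finset.sum_eq_single (e'.symm (e j + u.1))]
      · simp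
      · intro b _ hb
        simp [Ne.symm hb]
      · simp
    · intro b _ hb
      simp [Ne.symm hb]
    · simp
  rw [htr]
  simp only [hB u, Matrix.mul_apply, conjTranspose_apply, of_apply, Finset.sum_mul, Finset.mul_sum,
    Matrix.star_apply, star_mul', star_stdAddChar, stdAddChar_mul_sub, ← hd]
  rw [Finset.sum_comm]
  conv_rhs => rw [Finset.sum_comm]
  refine Finset.sum_congr rfl fun s _ => ?_
  rw [Finset.sum_comm]
  refine Finset.sum_congr rfl fun r _ => Finset.sum_congr rfl fun w _ => ?_
  simp only [star_inv₀, Complex.star_def, Complex.conj_ofReal]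
  ring

theorem sum_single_equiv {n : Type*} [Fintype n] (φ : n ≃ k) : ∑ i, single (φ i) (φ i) (1 : ℂ) = (1 : Matrix k k ℂ) := by
  rw [Equiv.sum_comp φ fun x => single x x (1 : ℂ)]
  ext i j
  by_cases h : i = j
  · subst h
    simp [Matrix.sum_apply, single_apply]
  · have : ∀ x, ¬ (x = i ∧ x = j) := fun x hx => h (hx.1.symm.trans hx.2)
    simp [Matrix.sum_apply, h, this]

/-- A measurement reproducing the statistics of the Bell measurement yields a channel. -/
theorem exists_channel {X : Type*}
    {σ : X → Matrix m m ℂ} {τ : X → Matrix n n ℂ} (e' : k ≃ ZMod d) (e : n ≃ ZMod d)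
    {Q : ZMod d × ZMod d → Matrix (k × m) (k × m) ℂ} (hQ : IsPOVM Q)
    (h : ∀ W x u, ((W ⊗ₖ σ x) * Q u).trace = ((W ⊗ₖ τ x) * bell e' e u).trace) :
    ∃ T : Matrix m m ℂ →CP Matrix n n ℂ,
      (∀ A : Matrix m m ℂ, (T A).trace = A.trace) ∧ ∀ x, τ x = T (σ x) := by
  obtain ⟨T, hT⟩ := exists_teleportation e' e hQ
  have hd : (d : ℂ) ≠ 0 := Nat.cast_ne_zero.2 (NeZero.ne d)
  refine ⟨T, fun A => ?_, fun x => ?_⟩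
  · simp only [trace, diag_apply, hT, sub_self, mul_zero, AddChar.map_zero_eq_one, one_mul]
    rw [← Finset.mul_sum, Finset.sum_comm]
    -- For fixed `u` the shift permutes the basis, so the diagonal matrix units add up to the
    -- identity.
    have h1 : ∀ u : ZMod d × ZMod d, ∑ i : n, ((single (e'.symm (e i + u.1))
        (e'.symm (e i + u.1)) (1 : ℂ) ⊗ₖ A) * Q u).trace =
        (((1 : Matrix k k ℂ) ⊗ₖ A) * Q u).trace := by
      intro u
      rw [← sum_single_equiv ((e.trans (Equiv.addRight u.1)).trans e'.symm), ← trace_sum,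
        ← Finset.sum_mul]
      congr 2
      ext a b
      simp [Matrix.sum_apply, Finset.sum_mul]
    change (d : ℂ)⁻¹ * ∑ u : ZMod d × ZMod d, ∑ i : n, ((single (e'.symm (e i + u.1))
        (e'.symm (e i + u.1)) (1 : ℂ) ⊗ₖ A) * Q u).trace = A.trace
    simp only [h1]
    rw [← trace_sum, ← Finset.mul_sum, hQ.2, Matrix.mul_one, trace_kronecker, trace_one,
      Fintype.card_congr e', ZMod.card, ← mul_assoc, inv_mul_cancel₀ hd, one_mul]
  · ext i j
    simp only [hT, h, trace_single_kronecker_mul_bell]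
    -- The phases cancel, leaving `d ^ 2` equal terms against the prefactor `d⁻¹ * d⁻¹`.
    have h1 : ∀ u : ZMod d × ZMod d, ZMod.stdAddChar (u.2 * (e i - e j)) *
        ((d : ℂ)⁻¹ * ZMod.stdAddChar (u.2 * (e j - e i)) * τ x i j) = (d : ℂ)⁻¹ * τ x i j := by
      intro u
      have : (ZMod.stdAddChar (u.2 * (e i - e j)) : ℂ) *
          ZMod.stdAddChar (u.2 * (e j - e i)) = 1 := by
        rw [← AddChar.map_add_eq_mul, ← mul_add, sub_add_sub_cancel, sub_self, mul_zero,
          AddChar.map_zero_eq_one]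
      linear_combination ((d : ℂ)⁻¹ * τ x i j) * this
    simp only [h1, Finset.sum_const, Finset.card_univ, Fintype.card_prod, ZMod.card, nsmul_eq_mul]
    push_cast
    field_simp

end Teleportation

end CQ

/-! ### The equivalence. -/

theorem mainTheorem9 {X Y R S S' : Type*} [Fintype X] [Fintype Y]
    [Fintype R] [DecidableEq R] [Fintype S] [DecidableEq S] [Nonempty S]
    [Fintype S'] [DecidableEq S'] (hS' : Fintype.card S' = Fintype.card S)
    (σ : X → Matrix R R ℂ) (hσ : ∀ x, CQ.IsDensity (σ x))
    (τ : X → Matrix S S ℂ) (hτ : ∀ x, CQ.IsDensity (τ x))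
    (ω : Y → Matrix S' S' ℂ) (hω : ∀ y, CQ.IsDensity (ω y))
    (hspan : Submodule.span ℂ (Set.range ω) = ⊤) :
    List.TFAE [
      -- domination in conditional min-entropy
      ∀ (U : Type) [Fintype U] [DecidableEq U] (q : U → ℝ) (c : U → Y × X → ℝ),
        q ∈ stdSimplex ℝ U → (∀ u, c u ∈ stdSimplex ℝ (Y × X)) →
        CQ.Hmin (CQ.cqState q fun u => CQ.mixture (c u) ω σ) ≤
          CQ.Hmin (CQ.cqState q fun u => CQ.mixture (c u) ω τ),
      -- domination in guessing probability
      ∀ (U : Type) [Fintype U] (q : U → ℝ) (c : U → Y × X → ℝ),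
        q ∈ stdSimplex ℝ U → (∀ u, c u ∈ stdSimplex ℝ (Y × X)) →
        CQ.guessProb q (fun u => CQ.mixture (c u) ω σ) ≥
          CQ.guessProb q (fun u => CQ.mixture (c u) ω τ),
      -- degradability by a completely positive trace-preserving map
      ∃ T : Matrix R R ℂ →CP Matrix S S ℂ,
        (∀ A : Matrix R R ℂ, (T A).trace = A.trace) ∧ ∀ x, τ x = T (σ x)] := by
  have hiff : ∀ (U : Type) [Fintype U] [DecidableEq U] (q : U → ℝ) (c : U → Y × X → ℝ),
      q ∈ stdSimplex ℝ U → (∀ u, c u ∈ stdSimplex ℝ (Y × X)) →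
      (CQ.Hmin (CQ.cqState q fun u => CQ.mixture (c u) ω σ) ≤
          CQ.Hmin (CQ.cqState q fun u => CQ.mixture (c u) ω τ) ↔
        CQ.guessProb q (fun u => CQ.mixture (c u) ω σ) ≥
          CQ.guessProb q (fun u => CQ.mixture (c u) ω τ)) := by
    intro U _ _ q c hq hc
    have hmσ := fun u => CQ.isDensity_mixture (hc u) hω hσ
    have hmτ := fun u => CQ.isDensity_mixture (hc u) hω hτ
    rw [CQ.Hmin_cqState hq hmσ, CQ.Hmin_cqState hq hmτ, neg_le_neg_iff,
      Real.logb_le_logb one_lt_two (CQ.guessProb_pos hq hmτ) (CQ.guessProb_pos hq hmσ), ge_iff_le]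
  tfae_have 1 → 2 := by
    classical
    exact fun h U _ q c hq hc => (hiff U q c hq hc).1 (h U q c hq hc)
  tfae_have 2 → 1 := fun h U _ _ q c hq hc => (hiff U q c hq hc).2 (h U q c hq hc)
  tfae_have 3 → 2 := by
    rintro ⟨T, hT, hTσ⟩ U _ q c hq hc
    have hU : Nonempty U := by
      by_contra h
      rw [not_nonempty_iff] at h
      simpa using hq.2
    obtain rfl : τ = fun x => T (σ x) := funext hTσ
    exact CQ.guessProb_le_of_cp T hT q c ω σ
  tfae_have 2 → 3 := by
    intro h
    have hd : NeZero (Fintype.card S) := ⟨Fintype.card_ne_zero⟩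
    -- Labelling both bases by `ZMod d` supplies the shifts and characters; this is where equality
    -- of the dimensions of `S'` and `S` enters.
    let e : S ≃ ZMod (Fintype.card S) := Fintype.equivOfCardEq (ZMod.card _).symm
    let e' : S' ≃ ZMod (Fintype.card S) := Fintype.equivOfCardEq (hS'.trans (ZMod.card _).symm)
    have hB := CQ.isPOVM_bell e' e
    obtain ⟨Q, hQ, hQs⟩ := CQ.exists_isPOVM_statistics_eq hω hσ hτ (h _) hB
    exact CQ.exists_channel e' e hQ
      (CQ.trace_eq_of_statistics_eq hω hspan hσ hτ hB hQ hQs)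
  tfae_finish
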